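/- Let $\ell \ge 1$ and let $\mathfrak{S}_{\ell+1}$ act on $\mathbb{R}^{\ell+1}$ by permuting the standard basis, $\sigma e_i = e_{\sigma(i)}$. Let $E \subset \mathbb{R}^{\ell+1}$ be the subspace of vectors with coordinate sum zero, let $\Phi = \{e_i - e_j : i \ne j\}$ be the root system of type $A_\ell$, and let $Z = \{x \in E : (\alpha, x) \in \mathbb{Z} \text{ for all } \alpha \in \Phi\}$ be its coweight lattice, on which $\mathfrak{S}_{\ell+1}$ acts. For an integer $q > 0$ let $$M(\mathcal{A};q) = \{\bar{x} \in Z/qZ : (e_i - e_j, x) \not\equiv 0 \pmod q \text{ for all } 1 \le i < j \le \ell+1\}$$ be the complement of the Coxeter arrangement $\mathcal{A}$ of type $A_\ell$ modulo $q$; it is stable under $\mathfrak{S}_{\ell+1}$. Let $\chi_{\mathcal{A},q} : \mathfrak{S}_{\ell+1} \to \mathbb{C}$ be the character of the permutation representation of $\mathfrak{S}_{\ell+1}$ on $\mathbb{C}M(\mathcal{A};q)$. For positive integers $g, n$ put $\varphi_g(n) = \#\{i \in \{1,\dots,n\} : \gcd(n,i) = g\}$. Then for every integer $q>0$ and every $\sigma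 \in \mathfrak{S}_{\ell+1}$: if $\sigma$ has cycle type $(d,\dots,d)$ with $g$ entries (fixed points count as cycles of length $1$, so $gd = \ell+1$) and $d \mid q$, then $$\chi_{\mathcal{A},q}(\sigma) = \varphi_g(\ell+1)\,(q-d)(q-2d)\cdots(q-(g-1)d);$$ in all other cases $\chi_{\mathcal{A},q}(\sigma) = 0$. Consequently, $q \mapsto \chi_{\mathcal{A},q}$ is a quasi-polynomial with minimum period $\ell+1$. That is, $n = \ell+1$ is the least positive integer $n$ for which there are polynomials $f^{(1)},\dots,f^{(n)}$ in one variable, with coefficients in the ring of functions $\mathfrak{S}_{\ell+1} \to \mathbb{C}$, such that $\chi_{\mathcal{A},q} = f^{(r)}(q)$ whenever $q>0$, $1 \le r \le n$ and $q \equiv r \pmod n$. -/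

import Mathlib

noncomputable section

namespace EquivariantCharacteristic

/-! ## Quasi-polynomials -/

/-- `n` is a period of `F : ℤ_{>0} → R` as a quasi-polynomial: there are constituents
`f 1, …, f n ∈ R[t]` with `F z = f r (z)` whenever `z ≡ r (mod n)`, `1 ≤ r ≤ n`.
Only the values of `F` at positive integers matter. -/
def IsPeriod {R : Type*} [CommRing R] (F : ℕ → R) (n : ℕ) : Prop :=
  0 < n ∧ ∃ f : ℕ → Polynomial R, ∀ r ∈ Finset.Icc 1 n, ∀ z : ℕ, 0 < z →
    z ≡ r [MOD n] → F z = (f r).eval (z : R)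

/-- `F` is a quasi-polynomial, and `n` is the smallest of its periods. -/
def IsMinimumPeriod {R : Type*} [CommRing R] (F : ℕ → R) (n : ℕ) : Prop :=
  IsLeast {m : ℕ | IsPeriod F m} n

/-! ## Permutation characters -/

/-- The permutation representation on `ℂX` of a group `Γ` acting on `X` through `φ`. -/
def permRep {Γ X : Type*} [Group Γ] (φ : Γ →* Equiv.Perm X) : Representation ℂ Γ (X →₀ ℂ) where
  toFun γ := Finsupp.lmapDomain ℂ ℂ (φ γ)
  map_one' := by ext; simp
  map_mul' γ δ := by ext; simp

/-- The character of the permutation representation. -/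
def permCharacter {Γ X : Type*} [Group Γ] (φ : Γ →* Equiv.Perm X) (γ : Γ) : ℂ :=
  LinearMap.trace ℂ (X →₀ ℂ) (permRep φ γ)

/-! ## Arrangements over a lattice with a group action -/

section General

variable {L Γ ι : Type*} [AddCommGroup L] [Group Γ]

/-- The subgroup `qL` of `L`. -/
def qMultiples (L : Type*) [AddCommGroup L] (q : ℕ) : Submodule ℤ L :=
  LinearMap.range ((q : ℤ) • (LinearMap.id : L →ₗ[ℤ] L))

/-- `L_q = L / qL`. -/
abbrev Reduction (L : Type*) [AddCommGroup L] (q : ℕ) : Type _ := L ⧸ qMultiples L q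

theorem qMultiples_le_comap (f : L →ₗ[ℤ] L) (q : ℕ) :
    qMultiples L q ≤ (qMultiples L q).comap f := by
  rintro _ ⟨y, rfl⟩
  exact ⟨f y, by simp⟩

/-- The action `ρ_q` on `L_q` induced by `ρ`, so that `ρ_q(γ) ∘ π_q = π_q ∘ ρ(γ)`. -/
def reductionRep (ρ : Representation ℤ Γ L) (q : ℕ) : Representation ℤ Γ (Reduction L q) where
  toFun γ := (qMultiples L q).mapQ (qMultiples L q) (ρ γ) (qMultiples_le_comap (ρ γ) q)
  map_one' := by ext; simp
  map_mul' γ δ := by ext; simp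

/-- `M(𝒜; q)`: the classes `x̄ ∈ L_q` with `α_i(x) ≢ 0 (mod q)` for all `i`, where the
arrangement `𝒜` is given by the linear forms `α_i ∈ L^∨`. -/
def modComplement (α : ι → Module.Dual ℤ L) (q : ℕ) : Set (Reduction L q) :=
  (qMultiples L q).mkQ '' {x : L | ∀ i, ¬ α i x ≡ 0 [ZMOD q]}

/-- The set `{±α_1, …, ±α_n}`. -/
def signedForms (α : ι → Module.Dual ℤ L) : Set (Module.Dual ℤ L) :=
  {β | ∃ i, β = α i ∨ β = -α i}

/-- The arrangement is `Γ`-invariant: `ρ^∨(γ){±α_i} = {±α_i}` for all `γ`, where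
`ρ^∨(γ)(α) = α ∘ ρ(γ)⁻¹`. -/
def IsInvariant (ρ : Representation ℤ Γ L) (α : ι → Module.Dual ℤ L) : Prop :=
  ∀ γ : Γ, ρ.dual γ '' signedForms α = signedForms α

theorem reductionRep_mem {ρ : Representation ℤ Γ L} {α : ι → Module.Dual ℤ L}
    (h : IsInvariant ρ α) (q : ℕ) (γ : Γ) {x : Reduction L q} (hx : x ∈ modComplement α q) :
    reductionRep ρ q γ x ∈ modComplement α q := by
  obtain ⟨y, hy, rfl⟩ := hx
  refine ⟨ρ γ y, fun i hi => ?_, by simp [reductionRep]⟩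
  have hm : ρ.dual γ⁻¹ (α i) ∈ signedForms α := by
    rw [← h γ⁻¹]
    exact ⟨α i, ⟨i, Or.inl rfl⟩, rfl⟩
  have he : ρ.dual γ⁻¹ (α i) y = α i (ρ γ y) := by
    simp [Representation.dual_apply, Module.Dual.transpose_apply]
  obtain ⟨j, hj | hj⟩ := hm
  · rw [hj] at he
    exact hy j (he ▸ hi)
  · rw [hj] at he
    refine hy j ?_
    rw [← he, LinearMap.neg_apply] at hi
    simpa using hi.neg

/-- The action of `Γ` on `M(𝒜; q)` for a `Γ`-invariant arrangement. -/
def complementAction (ρ : Representation ℤ Γ L) (α : ι → Module.Dual ℤ L)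
    (h : IsInvariant ρ α) (q : ℕ) : Γ →* Equiv.Perm (modComplement α q) where
  toFun γ :=
    { toFun := fun x => ⟨reductionRep ρ q γ x, reductionRep_mem h q γ x.2⟩
      invFun := fun x => ⟨reductionRep ρ q γ⁻¹ x, reductionRep_mem h q γ⁻¹ x.2⟩
      left_inv := fun x => by ext; simp
      right_inv := fun x => by ext; simp }
  map_one' := by ext x; simp
  map_mul' γ δ := by ext x; simp

/-- `χ_{𝒜,q}`: the permutation character of `Γ` on `M(𝒜; q)`. -/
def chi (ρ : Representation ℤ Γ L) (α : ι → Module.Dual ℤ L) (h : IsInvariant ρ α) (q : ℕ) :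
    Γ → ℂ :=
  permCharacter (complementAction ρ α h q)

end General

/-! ## Type `A_ℓ` -/

namespace TypeA

/-- `ℝ^{ℓ+1}` with its Euclidean inner product. -/
abbrev Ambient (ℓ : ℕ) : Type := EuclideanSpace ℝ (Fin (ℓ + 1))

/-- The standard basis vector `e_i`. -/
def e {ℓ : ℕ} (i : Fin (ℓ + 1)) : Ambient ℓ := EuclideanSpace.single i 1

/-- The space `E` of vectors whose coordinates sum to zero. -/
def sumZero (ℓ : ℕ) : Submodule ℝ (Ambient ℓ) where
  carrier := {x | ∑ i, x i = 0}
  zero_mem' := by simp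
  add_mem' := by
    intro x y hx hy
    simp only [Set.mem_ofPred_eq] at hx hy
    simp [Finset.sum_add_distrib, hx, hy]
  smul_mem' := by
    intro c x hx
    simp only [Set.mem_ofPred_eq] at hx
    simp [← Finset.mul_sum, hx]

/-- The root system of type `A_ℓ`. -/
def roots (ℓ : ℕ) : Set (Ambient ℓ) := {a | ∃ i j, i ≠ j ∧ a = e i - e j}

/-- The coweight lattice `Z = {x ∈ E : (α, x) ∈ ℤ for all roots α}`. -/
def coweightLattice (ℓ : ℕ) : Submodule ℤ (Ambient ℓ) where
  carrier := {x | x ∈ sumZero ℓ ∧ ∀ a ∈ roots ℓ, ∃ m : ℤ, inner ℝ a x = (m : ℝ)}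
  zero_mem' := ⟨zero_mem _, fun a _ => ⟨0, by simp⟩⟩
  add_mem' := by
    rintro x y ⟨hx, hx'⟩ ⟨hy, hy'⟩
    refine ⟨add_mem hx hy, fun a ha => ?_⟩
    obtain ⟨m, hm⟩ := hx' a ha
    obtain ⟨k, hk⟩ := hy' a ha
    exact ⟨m + k, by rw [inner_add_right, hm, hk]; push_cast; rfl⟩
  smul_mem' := by
    rintro c x ⟨hx, hx'⟩
    refine ⟨zsmul_mem hx c, fun a ha => ?_⟩
    obtain ⟨m, hm⟩ := hx' a ha
    refine ⟨c * m, ?_⟩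
    rw [← Int.cast_smul_eq_zsmul ℝ c x, inner_smul_right, hm]
    push_cast
    rfl

/-- The positive roots `e_i - e_j`, `i < j`, by their index pairs. -/
abbrev PosIndex (ℓ : ℕ) : Type := {p : Fin (ℓ + 1) × Fin (ℓ + 1) // p.1 < p.2}

theorem exists_inner_eq {ℓ : ℕ} (i j : Fin (ℓ + 1)) (x : coweightLattice ℓ) :
    ∃ m : ℤ, inner ℝ (e i - e j) (x : Ambient ℓ) = (m : ℝ) := by
  by_cases hij : i = j
  · exact ⟨0, by simp [hij]⟩
  · exact x.2.2 _ ⟨i, j, hij, rfl⟩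

theorem floor_inner {ℓ : ℕ} (i j : Fin (ℓ + 1)) (x : coweightLattice ℓ) :
    ((⌊inner ℝ (e i - e j) (x : Ambient ℓ)⌋ : ℤ) : ℝ) = inner ℝ (e i - e j) (x : Ambient ℓ) := by
  obtain ⟨m, hm⟩ := exists_inner_eq i j x
  rw [hm, Int.floor_intCast]

/-- The integral linear form `x ↦ (e_i - e_j, x)` on the coweight lattice. The inner product is an
integer there, and the floor only turns this real number into an element of `ℤ`. -/
def rootForm {ℓ : ℕ} (i j : Fin (ℓ + 1)) : Module.Dual ℤ (coweightLattice ℓ) where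
  toFun x := ⌊inner ℝ (e i - e j) (x : Ambient ℓ)⌋
  map_add' x y := by
    apply Int.cast_injective (α := ℝ)
    rw [Int.cast_add, floor_inner, floor_inner, floor_inner, Submodule.coe_add, inner_add_right]
  map_smul' c x := by
    apply Int.cast_injective (α := ℝ)
    rw [floor_inner, RingHom.id_apply, smul_eq_mul, Int.cast_mul, floor_inner,
      Submodule.coe_smul, ← Int.cast_smul_eq_zsmul ℝ c (x : Ambient ℓ), inner_smul_right]

theorem rootForm_cast {ℓ : ℕ} (i j : Fin (ℓ + 1)) (x : coweightLattice ℓ) :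
    ((rootForm i j x : ℤ) : ℝ) = inner ℝ (e i - e j) (x : Ambient ℓ) :=
  floor_inner i j x

/-- The Coxeter arrangement of type `A_ℓ`: its forms are the positive roots. -/
def coxeterForms (ℓ : ℕ) : PosIndex ℓ → Module.Dual ℤ (coweightLattice ℓ) :=
  fun p => rootForm p.1.1 p.1.2

/-- The linear isometry of `ℝ^{ℓ+1}` that permutes the standard basis by `e_i ↦ e_{σ(i)}`. -/
def permAct {ℓ : ℕ} (σ : Equiv.Perm (Fin (ℓ + 1))) : Ambient ℓ ≃ₗᵢ[ℝ] Ambient ℓ :=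
  LinearIsometryEquiv.piLpCongrLeft 2 ℝ ℝ σ

theorem permAct_e {ℓ : ℕ} (σ : Equiv.Perm (Fin (ℓ + 1))) (i : Fin (ℓ + 1)) :
    permAct σ (e i) = e (σ i) := by
  simp [permAct, e]

theorem permAct_apply {ℓ : ℕ} (σ : Equiv.Perm (Fin (ℓ + 1))) (x : Ambient ℓ) (i : Fin (ℓ + 1)) :
    permAct σ x i = x (σ.symm i) := by
  simp [permAct]

theorem inner_permAct {ℓ : ℕ} (σ : Equiv.Perm (Fin (ℓ + 1))) (i j : Fin (ℓ + 1)) (x : Ambient ℓ) :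
    inner ℝ (e i - e j) (permAct σ x) = inner ℝ (e (σ.symm i) - e (σ.symm j)) x := by
  have h : e i - e j = permAct σ (e (σ.symm i) - e (σ.symm j)) := by
    rw [map_sub, permAct_e, permAct_e, Equiv.apply_symm_apply, Equiv.apply_symm_apply]
  rw [h, LinearIsometryEquiv.inner_map_map]

theorem permAct_mem {ℓ : ℕ} (σ : Equiv.Perm (Fin (ℓ + 1))) {x : Ambient ℓ}
    (hx : x ∈ coweightLattice ℓ) : permAct σ x ∈ coweightLattice ℓ := by
  refine ⟨?_, ?_⟩
  · have h : ∑ i, x i = 0 := hx.1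
    change ∑ i, permAct σ x i = 0
    simp only [permAct_apply]
    rw [Equiv.sum_comp σ.symm (fun i => x i), h]
  · rintro _ ⟨i, j, -, rfl⟩
    rw [inner_permAct]
    exact exists_inner_eq _ _ ⟨x, hx⟩

/-- The action `ρ_Z` of `𝔖_{ℓ+1}` on the coweight lattice, by permutation of coordinates. -/
def weylRep (ℓ : ℕ) : Representation ℤ (Equiv.Perm (Fin (ℓ + 1))) (coweightLattice ℓ) where
  toFun σ :=
    { toFun := fun x => ⟨permAct σ x, permAct_mem σ x.2⟩
      map_add' := fun x y => by ext; simp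
      map_smul' := fun c x => by ext; simp }
  map_one' := by
    ext x i
    simp only [LinearMap.coe_mk, AddHom.coe_mk, permAct_apply]
    rfl
  map_mul' σ τ := by
    ext x i
    simp only [LinearMap.coe_mk, AddHom.coe_mk, permAct_apply, Module.End.mul_apply]
    rfl

theorem dual_rootForm {ℓ : ℕ} (σ : Equiv.Perm (Fin (ℓ + 1))) (i j : Fin (ℓ + 1)) :
    (weylRep ℓ).dual σ (rootForm i j) = rootForm (σ i) (σ j) := by
  ext x
  apply Int.cast_injective (α := ℝ)
  rw [rootForm_cast, Representation.dual_apply, Module.Dual.transpose_apply,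
    LinearMap.comp_apply, rootForm_cast]
  change inner ℝ (e i - e j) (permAct σ⁻¹ (x : Ambient ℓ)) = _
  rw [inner_permAct]
  rfl

theorem rootForm_swap {ℓ : ℕ} (i j : Fin (ℓ + 1)) : rootForm i j = -rootForm j i := by
  ext x
  apply Int.cast_injective (α := ℝ)
  rw [LinearMap.neg_apply, Int.cast_neg, rootForm_cast, rootForm_cast, ← inner_neg_left, neg_sub]

theorem rootForm_mem {ℓ : ℕ} {i j : Fin (ℓ + 1)} (h : i ≠ j) :
    rootForm i j ∈ signedForms (coxeterForms ℓ) := by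
  rcases lt_or_gt_of_ne h with h | h
  · exact ⟨⟨(i, j), h⟩, Or.inl rfl⟩
  · exact ⟨⟨(j, i), h⟩, Or.inr (rootForm_swap i j)⟩

theorem exists_rootForm {ℓ : ℕ} {β : Module.Dual ℤ (coweightLattice ℓ)}
    (h : β ∈ signedForms (coxeterForms ℓ)) : ∃ i j, i ≠ j ∧ β = rootForm i j := by
  obtain ⟨⟨⟨i, j⟩, hij⟩, rfl | rfl⟩ := h
  · exact ⟨i, j, ne_of_lt hij, rfl⟩
  · exact ⟨j, i, ne_of_gt hij, (rootForm_swap j i).symm⟩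

theorem coxeter_isInvariant (ℓ : ℕ) : IsInvariant (weylRep ℓ) (coxeterForms ℓ) := by
  intro σ
  ext β
  constructor
  · rintro ⟨β', h, rfl⟩
    obtain ⟨i, j, hij, rfl⟩ := exists_rootForm h
    rw [dual_rootForm]
    exact rootForm_mem (σ.injective.ne hij)
  · intro h
    obtain ⟨i, j, hij, rfl⟩ := exists_rootForm h
    refine ⟨rootForm (σ.symm i) (σ.symm j), rootForm_mem (σ.symm.injective.ne hij), ?_⟩
    rw [dual_rootForm, Equiv.apply_symm_apply, Equiv.apply_symm_apply]

/-- `χ_{𝒜,q}` for the Coxeter arrangement `𝒜` of type `A_ℓ`, a function on `𝔖_{ℓ+1}`. -/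
def chiA (ℓ q : ℕ) : Equiv.Perm (Fin (ℓ + 1)) → ℂ :=
  chi (weylRep ℓ) (coxeterForms ℓ) (coxeter_isInvariant ℓ) q

/-- `φ_g(n) = #{i ∈ {1, …, n} : gcd(n, i) = g}`. -/
def phi (g n : ℕ) : ℕ := ((Finset.Icc 1 n).filter fun i => Nat.gcd n i = g).card

/-- `σ` has cycle type `(d, …, d)` with `g` entries, fixed points being cycles of length 1. -/
def HasRectangularCycleType {ℓ : ℕ} (σ : Equiv.Perm (Fin (ℓ + 1))) (g d : ℕ) : Prop :=
  σ.partition.parts = Multiset.replicate g d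

end TypeA

end EquivariantCharacteristic

end

/-!
Sending `x` to `((e_i - e_0, x) mod q)_i` identifies `Z / qZ` with the functions
`f : {0, …, ℓ} → ℤ/q` such that `f 0 = 0`, and `M(𝒜; q)` with the injective ones among them
(`coords_injective`, `exists_coords_eq`, `mem_modComplement_iff`). The value of the permutation
character at `σ` is the number of fixed points of `σ`, and a class is fixed exactly when
`f ∘ σ = f + c` for a constant `c`, necessarily `c = f (σ 0)`
(`chiA_eq_card_normalizedInjections`).

If such an injection exists, every cycle of `σ` has the order `d` of `c` as its length
(`minimalPeriod_eq_addOrderOf`). So `σ` has cycle type `(d, …, d)`, and `d` divides `q`; in all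
other cases the character vanishes. Conversely, let `σ` have cycle type `(d, …, d)` with `g` entries
and let `d ∣ q`. Without the normalization `f 0 = 0` there are `q` times as many functions. For each
of the `φ(d)` elements `c` of order `d`, the function `f` is determined by its values at one point
of each cycle, and these can be any `g` elements in distinct cosets of the subgroup generated by
`c`. Their number is `(q/d) (q/d - 1) ⋯ (q/d - g + 1) · d ^ g`, and dividing by `q` gives the
formula (`card_normalizedInjections`), because `φ_g(ℓ + 1) = φ(d)`.

Only the condition `d ∣ q`, where `d ∣ ℓ + 1`, distinguishes the residue classes of `q`, so `ℓ + 1`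
is a period. At a cycle of length `ℓ + 1` the character is nonzero exactly when `ℓ + 1 ∣ q`
(`chiA_finRotate_ne_zero_iff`). For `0 < m < ℓ + 1` the multiples of `m` include infinitely many
that are not divisible by `ℓ + 1` and some that are, so no single polynomial gives the values at all
of them, and `m` is not a period.
-/

/-! ### Permutations all of whose cycles have the same length -/

namespace EquivariantCharacteristic

open Equiv Function

theorem minimalPeriod_eq_iff_forall_dvd {α : Type*} {f : α → α} {x : α} {d : ℕ} :
    minimalPeriod f x = d ↔ ∀ k, f^[k] x = x ↔ d ∣ k := by
  constructor
  · rintro rfl k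
    exact isPeriodicPt_iff_minimalPeriod_dvd
  · intro h
    apply Nat.dvd_antisymm
    · exact isPeriodicPt_iff_minimalPeriod_dvd.mp ((h d).mpr dvd_rfl)
    · exact (h _).mp (isPeriodicPt_minimalPeriod f x)

section Perm

variable {α : Type*} [Fintype α] [DecidableEq α]

theorem minimalPeriod_eq_card_support_cycleOf {σ : Perm α} {x : α} (hx : x ∈ σ.support) :
    minimalPeriod σ x = (σ.cycleOf x).support.card := by
  rw [minimalPeriod_eq_iff_forall_dvd]
  intro k
  rw [← Perm.coe_pow]
  exact (Perm.isCycleOn_support_cycleOf σ x).pow_apply_eq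
    (Perm.mem_support_cycleOf_iff.mpr ⟨Perm.SameCycle.refl _ _, hx⟩)

/-- The cycle type of `σ`, with fixed points as cycles of length one, consists of the periods of
the points under `σ`. -/
theorem mem_parts_partition_iff {σ : Perm α} {r : ℕ} :
    r ∈ σ.partition.parts ↔ ∃ x, minimalPeriod σ x = r := by
  rw [Perm.parts_partition, Multiset.mem_add, Multiset.mem_replicate, Perm.cycleType_def,
    Multiset.mem_map]
  constructor
  · rintro (⟨c, hc, rfl⟩ | ⟨h, rfl⟩)
    · have hc' : c ∈ σ.cycleFactorsFinset := hc
      obtain ⟨x, hx⟩ := (Perm.mem_cycleFactorsFinset_iff.mp hc').1.nonempty_support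
      refine ⟨x, ?_⟩
      rw [minimalPeriod_eq_card_support_cycleOf
        (Perm.mem_cycleFactorsFinset_support_le hc' hx), ← Perm.cycle_is_cycleOf hx hc']
      rfl
    · have hne : σ.support ≠ Finset.univ := by
        intro hu
        rw [hu, Finset.card_univ, Nat.sub_self] at h
        exact h rfl
      obtain ⟨x, hx⟩ := not_forall.mp (mt Finset.eq_univ_iff_forall.mpr hne)
      exact ⟨x, minimalPeriod_eq_one_iff_isFixedPt.mpr (Perm.notMem_support.mp hx)⟩
  · rintro ⟨x, rfl⟩
    by_cases hx : x ∈ σ.support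
    · exact Or.inl ⟨σ.cycleOf x, Perm.cycleOf_mem_cycleFactorsFinset_iff.mpr hx,
        (minimalPeriod_eq_card_support_cycleOf hx).symm⟩
    · refine Or.inr ⟨?_, minimalPeriod_eq_one_iff_isFixedPt.mpr (Perm.notMem_support.mp hx)⟩
      have := Finset.card_lt_univ_of_notMem hx
      omega

theorem exists_parts_partition_eq_replicate {σ : Perm α} {d : ℕ}
    (h : ∀ x, minimalPeriod σ x = d) :
    ∃ g, g * d = Fintype.card α ∧ σ.partition.parts = Multiset.replicate g d := by
  have h1 : σ.partition.parts = Multiset.replicate _ d := Multiset.eq_replicate_card.mpr fun r hr =>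
    have ⟨x, hx⟩ := mem_parts_partition_iff.mp hr
    hx.symm.trans (h x)
  refine ⟨_, ?_, h1⟩
  have h2 := σ.partition.parts_sum
  rwa [h1, Multiset.sum_replicate, smul_eq_mul] at h2

/-- A permutation has rectangular cycle type exactly when all its points have the same period. -/
theorem parts_partition_eq_replicate_iff {σ : Perm α} {g d : ℕ} (h : g * d = Fintype.card α)
    (hd : 0 < d) :
    σ.partition.parts = Multiset.replicate g d ↔ ∀ x, minimalPeriod σ x = d := by
  constructor
  · intro h' x
    exact Multiset.eq_of_mem_replicate (h' ▸ mem_parts_partition_iff.mpr ⟨x, rfl⟩)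
  · intro h'
    obtain ⟨g', hg', hparts⟩ := exists_parts_partition_eq_replicate h'
    rwa [Nat.eq_of_mul_eq_mul_right hd (hg'.trans h.symm)] at hparts

/-- A permutation of `g * d` points all of whose cycles have length `d` is, up to relabelling,
the shift of the second coordinate of `Fin g × ZMod d`. -/
theorem exists_equiv_prod_zmod {σ : Perm α} {g d : ℕ} (h : g * d = Fintype.card α) (hd : 0 < d)
    (hσ : ∀ x, minimalPeriod σ x = d) :
    ∃ e : α ≃ Fin g × ZMod d, ∀ x, e (σ x) = ((e x).1, (e x).2 + 1) := by
  have : NeZero d := ⟨hd.ne'⟩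
  let e₀ : α ≃ Fin g × ZMod d := Fintype.equivOfCardEq (by simp [h])
  let τ : Perm α := e₀.symm.permCongr (Equiv.prodCongr (Equiv.refl _) (Equiv.addRight 1))
  have hτ : ∀ x, e₀ (τ x) = ((e₀ x).1, (e₀ x).2 + 1) := fun x => by simp [τ, Prod.map]
  have hpow : ∀ k x, e₀ (τ^[k] x) = ((e₀ x).1, (e₀ x).2 + k) := by
    intro k x
    induction k with
    | zero => simp
    | succ k ih => rw [iterate_succ_apply', hτ, ih, Nat.cast_succ, add_assoc]
  have hper : ∀ x, minimalPeriod τ x = d := by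
    intro x
    rw [minimalPeriod_eq_iff_forall_dvd]
    intro k
    rw [← e₀.apply_eq_iff_eq, hpow, Prod.ext_iff, ← ZMod.natCast_eq_zero_iff]
    simp
  have hconj : IsConj σ τ := by
    rw [Perm.partition_eq_of_isConj]
    ext1
    rw [(parts_partition_eq_replicate_iff h hd).mpr hσ,
      (parts_partition_eq_replicate_iff h hd).mpr hper]
  obtain ⟨c, hc⟩ := isConj_iff.mp hconj
  refine ⟨c.trans e₀, fun x => ?_⟩
  have hx : c (σ x) = τ (c x) := by rw [← hc]; simp
  rw [Equiv.trans_apply, hx, hτ]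
  rfl

end Perm

/-! ### Injections that turn a permutation into a translation -/

section Counting

/-- The functions `h : ι → A` that are injective modulo a subgroup `H` correspond to pairs of an
embedding of `ι` in `A ⧸ H` and a function `ι → H`, through a choice of coset representatives. -/
noncomputable def injectiveModEquiv (ι : Type*) {A : Type*} [AddCommGroup A] (H : AddSubgroup A) :
    {h : ι → A // Injective fun i => (h i : A ⧸ H)} ≃ (ι ↪ A ⧸ H) × (ι → H) where
  toFun h := (⟨fun i => (h.1 i : A ⧸ H), h.2⟩,
    fun i => ⟨-(h.1 i : A ⧸ H).out + h.1 i, QuotientAddGroup.eq.mp (Quotient.out_eq' _)⟩)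
  invFun p := ⟨fun i => (p.1 i).out + p.2 i, by
    have : (fun i => (((p.1 i).out + p.2 i : A) : A ⧸ H)) = p.1 := by
      ext i
      rw [QuotientAddGroup.mk_add_of_mem _ (p.2 i).2, QuotientAddGroup.out_eq']
    rw [this]
    exact p.1.injective⟩
  left_inv h := by ext i; simp
  right_inv p := by
    have : ∀ i, (((p.1 i).out + p.2 i : A) : A ⧸ H) = p.1 i := fun i => by
      rw [QuotientAddGroup.mk_add_of_mem _ (p.2 i).2, QuotientAddGroup.out_eq']
    ext i
    · exact this i
    · simp only [this, neg_add_cancel_left]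

theorem card_injective_mod_zmultiples {A : Type*} [AddCommGroup A] [Finite A] (c : A) (g : ℕ) :
    Nat.card {h : Fin g → A // Injective fun i => (h i : A ⧸ AddSubgroup.zmultiples c)} =
      (Nat.card A / addOrderOf c).descFactorial g * addOrderOf c ^ g := by
  have := Fintype.ofFinite (A ⧸ AddSubgroup.zmultiples c)
  have hq : Nat.card A / addOrderOf c = Nat.card (A ⧸ AddSubgroup.zmultiples c) := by
    rw [AddSubgroup.card_eq_card_quotient_mul_card_addSubgroup (AddSubgroup.zmultiples c),
      Nat.card_zmultiples, Nat.mul_div_cancel _ (addOrderOf_pos c)]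
  rw [Nat.card_congr (injectiveModEquiv _ _), Nat.card_prod, Nat.card_fun, Nat.card_zmultiples,
    Nat.card_eq_fintype_card, Fintype.card_embedding_eq, Fintype.card_fin, hq,
    Nat.card_eq_fintype_card, Nat.card_eq_fintype_card, Fintype.card_fin]

/-- If `c` has order `d`, then the injections `f` from `Fin g × ZMod d` that turn the shift of the
second coordinate into translation by `c` are determined by the values `f (i, 0)`, and these can be
any `g` elements in distinct cosets of the subgroup generated by `c`. -/
noncomputable def injectiveEquivariantEquiv {α A : Type*} [AddCommGroup A] {σ : α → α} {g d : ℕ}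
    (e : α ≃ Fin g × ZMod d) (he : ∀ x, e (σ x) = ((e x).1, (e x).2 + 1)) (hd : 0 < d) {c : A}
    (hc : addOrderOf c = d) :
    {f : α → A // Injective f ∧ ∀ x, f (σ x) = f x + c} ≃
      {h : Fin g → A // Injective fun i => (h i : A ⧸ AddSubgroup.zmultiples c)} :=
  have : NeZero d := ⟨hd.ne'⟩
  -- `m k = k • c`, an isomorphism of `ZMod d` onto the subgroup generated by `c`
  let m : ZMod d →+ A := ZMod.lift d ⟨zmultiplesHom A c, by simp [← hc, addOrderOf_nsmul_eq_zero]⟩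
  have hm : ∀ z : ℤ, m z = z • c := fun z => by simp [m]
  have hm1 : m 1 = c := by simpa using hm 1
  have hinj : Injective m := by
    rw [ZMod.lift_injective]
    intro z hz
    rw [ZMod.intCast_zmod_eq_zero_iff_dvd, ← hc]
    exact addOrderOf_dvd_iff_zsmul_eq_zero.mpr hz
  have hmk : ∀ (x y : A) a b, x + m a = y + m b →
      (x : A ⧸ AddSubgroup.zmultiples c) = (y : A ⧸ AddSubgroup.zmultiples c) := by
    intro x y a b h
    obtain ⟨z, hz⟩ := ZMod.intCast_surjective (a - b)
    refine QuotientAddGroup.eq.mpr ⟨z, ?_⟩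
    change z • c = _
    rw [← hm, hz, map_sub, neg_add_eq_sub, sub_eq_sub_iff_add_eq_add, add_comm, h]
  have hrec : ∀ f : α → A, (∀ x, f (σ x) = f x + c) →
      ∀ i a, f (e.symm (i, a)) = f (e.symm (i, 0)) + m a := by
    intro f hf i a
    obtain ⟨k, rfl⟩ := ZMod.natCast_zmod_surjective a
    induction k with
    | zero => simp
    | succ k ih =>
      have : e.symm (i, ((k + 1 : ℕ) : ZMod d)) = σ (e.symm (i, (k : ZMod d))) := by
        rw [Equiv.symm_apply_eq, he]
        simp
      rw [this, hf, ih, Nat.cast_succ, map_add, hm1, add_assoc]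
  { toFun := fun f => ⟨fun i => f.1 (e.symm (i, 0)), by
      intro i j hij
      obtain ⟨z, hz⟩ := QuotientAddGroup.eq.mp hij
      have hz' : f.1 (e.symm (j, 0)) = f.1 (e.symm (i, (z : ZMod d))) := by
        rw [hrec f.1 f.2.2 i z, hm]
        exact (eq_neg_add_iff_add_eq.mp hz).symm
      exact (Prod.ext_iff.mp (e.symm.injective (f.2.1 hz'))).1.symm⟩
    invFun := fun h => ⟨fun x => h.1 (e x).1 + m (e x).2, by
      refine ⟨fun x y hxy => e.injective ?_, fun x => ?_⟩
      · have h1 : (e x).1 = (e y).1 := h.2 (hmk _ _ _ _ hxy)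
        simp only [h1, add_right_inj] at hxy
        exact Prod.ext h1 (hinj hxy)
      · simp only [he, map_add, hm1, add_assoc]⟩
    left_inv := fun f => by
      ext x
      change f.1 (e.symm ((e x).1, 0)) + m (e x).2 = f.1 x
      rw [← hrec f.1 f.2.2]
      simp
    right_inv := fun h => by
      ext i
      simp }

/-- If an injection turns `σ` into translation by `c`, then every point has period the order of `c`
under `σ`. -/
theorem minimalPeriod_eq_addOrderOf {α A : Type*} [AddCommGroup A] {σ : α → α} {f : α → A} {c : A}
    (hf : Injective f) (h : ∀ x, f (σ x) = f x + c) (x : α) :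
    minimalPeriod σ x = addOrderOf c := by
  have hk : ∀ k, f (σ^[k] x) = f x + k • c := by
    intro k
    induction k with
    | zero => simp
    | succ k ih => rw [iterate_succ_apply', h, ih, succ_nsmul, add_assoc]
  rw [minimalPeriod_eq_iff_forall_dvd]
  intro k
  rw [← hf.eq_iff, hk, add_eq_left, addOrderOf_dvd_iff_nsmul_eq_zero]

/-- The injections `f : α → A` that vanish at `x₀` and turn `σ` into a translation. Evaluating
at `x₀` shows that the translation is by `f (σ x₀)`. -/
def NormalizedInjections {α A : Type*} [AddCommGroup A] (σ : α → α) (x₀ : α) : Set (α → A) :=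
  {f | Injective f ∧ f x₀ = 0 ∧ ∀ x, f (σ x) = f x + f (σ x₀)}

/-- Translating by constants, every injection that turns `σ` into a translation is normalized in
exactly one way. -/
def prodNormalizedInjectionsEquiv {α A : Type*} [AddCommGroup A] {σ : α → α} (x₀ : α) {d : ℕ}
    (hσ : minimalPeriod σ x₀ = d) :
    A × NormalizedInjections (A := A) σ x₀ ≃
      Σ c : {c : A // addOrderOf c = d}, {f : α → A // Injective f ∧ ∀ x, f (σ x) = f x + c} where
  toFun p := ⟨⟨p.2.1 (σ x₀), (minimalPeriod_eq_addOrderOf p.2.2.1 p.2.2.2.2 x₀).symm.trans hσ⟩,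
    fun x => p.2.1 x + p.1, fun x y h => p.2.2.1 (add_right_cancel h), fun x => by
      exact (congrArg (· + p.1) (p.2.2.2.2 x)).trans (add_right_comm _ _ _)⟩
  invFun s := (s.2.1 x₀, ⟨fun x => s.2.1 x - s.2.1 x₀,
    fun x y h => s.2.2.1 (sub_left_injective h), sub_self _, fun x => by
      simp only [s.2.2.2 x, s.2.2.2 x₀]; abel⟩)
  left_inv p := by
    ext
    · simp [p.2.2.2.1]
    · simp [p.2.2.2.1]
  right_inv s := by
    obtain ⟨⟨c, hc⟩, f, hf, hfc⟩ := s
    have : f (σ x₀) - f x₀ = c := by rw [hfc]; abel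
    subst this
    simp

theorem card_mul_card_normalizedInjections {α : Type*} [Fintype α] [DecidableEq α]
    {σ : Equiv.Perm α} (x₀ : α) {g d q : ℕ} (hq : 0 < q) (h : g * d = Fintype.card α) (hd : d ∣ q)
    (hσ : ∀ x, minimalPeriod σ x = d) :
    q * Nat.card (NormalizedInjections (A := ZMod q) σ x₀) =
      d.totient * ((q / d).descFactorial g * d ^ g) := by
  have : NeZero q := ⟨hq.ne'⟩
  have hd0 : 0 < d := Nat.pos_of_dvd_of_pos hd hq
  obtain ⟨e, he⟩ := exists_equiv_prod_zmod h hd0 hσ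
  have hc : ∀ c : {c : ZMod q // addOrderOf c = d},
      Nat.card {f : α → ZMod q // Injective f ∧ ∀ x, f (σ x) = f x + c} =
        (q / d).descFactorial g * d ^ g := by
    intro c
    rw [Nat.card_congr (injectiveEquivariantEquiv e he hd0 c.2), card_injective_mod_zmultiples,
      c.2, Nat.card_zmod]
  have h1 := Nat.card_congr (prodNormalizedInjectionsEquiv (A := ZMod q) x₀ (hσ x₀))
  rw [Nat.card_prod, Nat.card_zmod, Nat.card_sigma, Finset.sum_congr rfl fun c _ => hc c,
    Finset.sum_const, smul_eq_mul] at h1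
  rw [h1, ← IsAddCyclic.card_addOrderOf_eq_totient (α := ZMod q) (by rwa [ZMod.card]),
    Finset.card_univ, Fintype.card_subtype]

/-- For `m < g` both sides vanish: the product has the factor with `i = m`. -/
theorem cast_descFactorial_mul_pow {R : Type*} [CommRing R] (m g d : ℕ) :
    ((m.descFactorial g * d ^ g : ℕ) : R) =
      ∏ i ∈ Finset.range g, (((m * d : ℕ) : R) - (i : R) * (d : R)) := by
  induction g with
  | zero => simp
  | succ g ih =>
    rw [Finset.prod_range_succ, ← ih, Nat.descFactorial_succ]
    rcases le_or_gt g m with hgm | hgm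
    · push_cast [Nat.cast_sub hgm]
      ring
    · simp [Nat.descFactorial_of_lt hgm]

theorem card_normalizedInjections {α : Type*} [Fintype α] [DecidableEq α] {σ : Equiv.Perm α}
    (x₀ : α) {g d q : ℕ} (hq : 0 < q) (h : g * d = Fintype.card α) (hd : d ∣ q)
    (hσ : ∀ x, minimalPeriod σ x = d) :
    (Nat.card (NormalizedInjections (A := ZMod q) σ x₀) : ℂ) =
      d.totient * ∏ i ∈ Finset.Ico 1 g, ((q : ℂ) - (i : ℂ) * (d : ℂ)) := by
  have hg : 0 < g := by
    have : 0 < Fintype.card α := Fintype.card_pos_iff.mpr ⟨x₀⟩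
    exact Nat.pos_of_mul_pos_right (h ▸ this)
  have hq' : (q : ℂ) ≠ 0 := Nat.cast_ne_zero.mpr hq.ne'
  have h1 := congrArg (Nat.cast (R := ℂ)) (card_mul_card_normalizedInjections x₀ hq h hd hσ)
  rw [Nat.cast_mul, Nat.cast_mul, cast_descFactorial_mul_pow, Nat.div_mul_cancel hd,
    Finset.range_eq_Ico, Finset.prod_eq_prod_Ico_succ_bot hg] at h1
  apply mul_left_cancel₀ hq'
  rw [h1]
  push_cast
  ring

end Counting

/-! ### Permutation characters count fixed points -/

theorem permCharacter_eq_card_fixedPoints {Γ X : Type*} [Group Γ] [Finite X] (φ : Γ →* Perm X)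
    (γ : Γ) : permCharacter φ γ = Nat.card {x : X // φ γ x = x} := by
  classical
  have := Fintype.ofFinite X
  rw [permCharacter, LinearMap.trace_eq_matrix_trace ℂ Finsupp.basisSingleOne, Matrix.trace,
    Nat.card_eq_fintype_card, Fintype.card_subtype, Finset.card_filter, Nat.cast_sum]
  refine Finset.sum_congr rfl fun x _ => ?_
  simp [permRep, LinearMap.toMatrix_apply, Finsupp.single_apply]

/-! ### The reduced coweight lattice in coordinates -/

namespace TypeA

variable {ℓ : ℕ}

theorem inner_e_sub_e (i j : Fin (ℓ + 1)) (x : Ambient ℓ) : inner ℝ (e i - e j) x = x i - x j := by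
  simp [e, inner_sub_left, EuclideanSpace.inner_single_left]

theorem rootForm_apply_cast (i j : Fin (ℓ + 1)) (x : coweightLattice ℓ) :
    ((rootForm i j x : ℤ) : ℝ) = (x : Ambient ℓ) i - (x : Ambient ℓ) j := by
  rw [rootForm_cast, inner_e_sub_e]

theorem rootForm_eq_sub (i j k : Fin (ℓ + 1)) (x : coweightLattice ℓ) :
    rootForm i j x = rootForm i k x - rootForm j k x := by
  apply Int.cast_injective (α := ℝ)
  rw [Int.cast_sub]
  simp only [rootForm_apply_cast]
  ring

theorem rootForm_weylRep (σ : Perm (Fin (ℓ + 1))) (i j : Fin (ℓ + 1)) (x : coweightLattice ℓ) :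
    rootForm i j (weylRep ℓ σ x) = rootForm (σ.symm i) (σ.symm j) x := by
  apply Int.cast_injective (α := ℝ)
  rw [rootForm_cast, rootForm_cast, ← inner_permAct]
  rfl

/-- The coordinates of a class in `Z / qZ`, normalized by translation so that the coordinate with
index `0` vanishes: `x ↦ ((e_i - e_0, x) mod q)_i`. -/
noncomputable def coords (ℓ q : ℕ) : Reduction (coweightLattice ℓ) q →ₗ[ℤ] (Fin (ℓ + 1) → ZMod q) :=
  (qMultiples (coweightLattice ℓ) q).liftQ
    (LinearMap.pi fun i => (Int.castAddHom (ZMod q)).toIntLinearMap ∘ₗ rootForm i 0) (by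
      rintro _ ⟨y, rfl⟩
      rw [LinearMap.mem_ker]
      ext i
      simp)

theorem coords_mkQ (q : ℕ) (x : coweightLattice ℓ) (i : Fin (ℓ + 1)) :
    coords ℓ q ((qMultiples (coweightLattice ℓ) q).mkQ x) i = (rootForm i 0 x : ZMod q) := rfl

theorem coords_zero (q : ℕ) (x : Reduction (coweightLattice ℓ) q) : coords ℓ q x 0 = 0 := by
  obtain ⟨y, rfl⟩ := Submodule.mkQ_surjective _ x
  rw [coords_mkQ, rootForm_eq_sub 0 0 0, sub_self, Int.cast_zero]

theorem coords_reductionRep (q : ℕ) (σ : Perm (Fin (ℓ + 1))) (x : Reduction (coweightLattice ℓ) q)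
    (i : Fin (ℓ + 1)) :
    coords ℓ q (reductionRep (weylRep ℓ) q σ x) i =
      coords ℓ q x (σ.symm i) - coords ℓ q x (σ.symm 0) := by
  obtain ⟨y, rfl⟩ := Submodule.mkQ_surjective _ x
  have : reductionRep (weylRep ℓ) q σ ((qMultiples (coweightLattice ℓ) q).mkQ y) =
      (qMultiples (coweightLattice ℓ) q).mkQ (weylRep ℓ σ y) := rfl
  rw [this, coords_mkQ, coords_mkQ, coords_mkQ, rootForm_weylRep,
    rootForm_eq_sub (σ.symm i) (σ.symm 0) 0, Int.cast_sub]

theorem coords_injective {q : ℕ} (hq : 0 < q) : Injective (coords ℓ q) := by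
  rw [← LinearMap.ker_eq_bot, LinearMap.ker_eq_bot']
  intro x hx
  obtain ⟨y, rfl⟩ := Submodule.mkQ_surjective _ x
  have hq' : (q : ℝ) ≠ 0 := Nat.cast_ne_zero.mpr hq.ne'
  have hy : ∀ i, ∃ m : ℤ, (y : Ambient ℓ) i - (y : Ambient ℓ) 0 = q * m := by
    intro i
    have hi := congrFun hx i
    rw [coords_mkQ, Pi.zero_apply, ZMod.intCast_zmod_eq_zero_iff_dvd] at hi
    obtain ⟨m, hm⟩ := hi
    exact ⟨m, by rw [← rootForm_apply_cast, hm]; push_cast; rfl⟩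
  choose m hm using hy
  -- `y / q` lies in the lattice: its coordinates sum to zero and differ by integers
  have hmem : (q : ℝ)⁻¹ • (y : Ambient ℓ) ∈ coweightLattice ℓ := by
    refine ⟨(sumZero ℓ).smul_mem _ y.2.1, ?_⟩
    rintro _ ⟨i, j, -, rfl⟩
    refine ⟨m i - m j, ?_⟩
    rw [inner_smul_right, inner_e_sub_e, inv_mul_eq_iff_eq_mul₀ hq']
    push_cast
    linear_combination hm i - hm j
  rw [Submodule.mkQ_apply, Submodule.Quotient.mk_eq_zero]
  refine ⟨⟨_, hmem⟩, ?_⟩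
  ext i
  simp [hq']

theorem exists_coords_eq {q : ℕ} (hq : 0 < q) {f : Fin (ℓ + 1) → ZMod q} (hf : f 0 = 0) :
    ∃ x, coords ℓ q x = f := by
  have : NeZero q := ⟨hq.ne'⟩
  -- lift the coordinates to integers and project orthogonally to the hyperplane of sum zero
  let s : ℝ := (∑ i, ((f i).val : ℝ)) / (ℓ + 1)
  let y : Ambient ℓ := WithLp.toLp 2 fun i => ((f i).val : ℝ) - s
  have hy : y ∈ coweightLattice ℓ := by
    constructor
    · change ∑ i, (((f i).val : ℝ) - s) = 0
      have : (ℓ + 1 : ℝ) ≠ 0 := by positivity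
      rw [Finset.sum_sub_distrib, Finset.sum_const, Finset.card_univ, Fintype.card_fin, nsmul_eq_mul]
      simp only [s]
      push_cast
      field_simp
      ring
    · rintro _ ⟨i, j, -, rfl⟩
      refine ⟨(f i).val - (f j).val, ?_⟩
      rw [inner_e_sub_e]
      simp [y]
  refine ⟨(qMultiples (coweightLattice ℓ) q).mkQ ⟨y, hy⟩, ?_⟩
  ext i
  have : rootForm i 0 (⟨y, hy⟩ : coweightLattice ℓ) = (f i).val := by
    apply Int.cast_injective (α := ℝ)
    rw [rootForm_apply_cast]
    simp [y, hf]
  rw [coords_mkQ, this]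
  simp

theorem mem_modComplement_iff {q : ℕ} {x : Reduction (coweightLattice ℓ) q} :
    x ∈ modComplement (coxeterForms ℓ) q ↔ Injective (coords ℓ q x) := by
  have key : ∀ (y : coweightLattice ℓ) i j, rootForm i j y ≡ 0 [ZMOD q] ↔
      coords ℓ q ((qMultiples (coweightLattice ℓ) q).mkQ y) i =
        coords ℓ q ((qMultiples (coweightLattice ℓ) q).mkQ y) j := by
    intro y i j
    rw [coords_mkQ, coords_mkQ, ← sub_eq_zero, ← Int.cast_sub, ← rootForm_eq_sub,
      ← ZMod.intCast_eq_intCast_iff, Int.cast_zero]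
  constructor
  · rintro ⟨y, hy, rfl⟩ i j hij
    rcases lt_trichotomy i j with h | h | h
    · exact absurd ((key y i j).mpr hij) (hy ⟨(i, j), h⟩)
    · exact h
    · exact absurd ((key y j i).mpr hij.symm) (hy ⟨(j, i), h⟩)
  · intro h
    obtain ⟨y, rfl⟩ := Submodule.mkQ_surjective _ x
    exact ⟨y, fun p hp => p.2.ne (h ((key y _ _).mp hp)), rfl⟩

theorem reductionRep_eq_self_iff {q : ℕ} (hq : 0 < q) (σ : Perm (Fin (ℓ + 1)))
    (x : Reduction (coweightLattice ℓ) q) :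
    reductionRep (weylRep ℓ) q σ x = x ↔
      ∀ i, coords ℓ q x (σ i) = coords ℓ q x i + coords ℓ q x (σ 0) := by
  rw [← (coords_injective hq).eq_iff, funext_iff]
  simp only [coords_reductionRep]
  constructor
  · intro h i
    have h0 := h (σ 0)
    have hi := h (σ i)
    rw [Equiv.symm_apply_apply] at h0 hi
    rw [coords_zero, zero_sub] at h0
    rw [← hi, ← h0, sub_eq_add_neg]
  · intro h i
    have h0 := h (σ.symm 0)
    have hi := h (σ.symm i)
    rw [Equiv.apply_symm_apply] at h0 hi
    rw [coords_zero] at h0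
    rw [hi, sub_eq_add_neg, eq_neg_of_add_eq_zero_left h0.symm, neg_neg]

theorem chiA_eq_card_normalizedInjections {q : ℕ} (hq : 0 < q) (σ : Perm (Fin (ℓ + 1))) :
    chiA ℓ q σ = Nat.card (NormalizedInjections (A := ZMod q) σ 0) := by
  have : NeZero q := ⟨hq.ne'⟩
  have : Finite (Reduction (coweightLattice ℓ) q) := Finite.of_injective _ (coords_injective hq)
  rw [chiA, chi, permCharacter_eq_card_fixedPoints]
  congr 1
  let F : {x : modComplement (coxeterForms ℓ) q //
      complementAction (weylRep ℓ) (coxeterForms ℓ) (coxeter_isInvariant ℓ) q σ x = x} →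
      NormalizedInjections (A := ZMod q) σ 0 :=
    fun x => ⟨coords ℓ q x.1.1, mem_modComplement_iff.mp x.1.2, coords_zero q _,
      (reductionRep_eq_self_iff hq σ x.1.1).mp (congrArg Subtype.val x.2)⟩
  refine Nat.card_eq_of_bijective F ⟨fun x y h => ?_, fun ⟨f, hf, hf0, hfσ⟩ => ?_⟩
  · exact Subtype.ext (Subtype.ext (coords_injective hq (congrArg Subtype.val h)))
  · obtain ⟨x, rfl⟩ := exists_coords_eq hq hf0
    exact ⟨⟨⟨x, mem_modComplement_iff.mpr hf⟩,
      Subtype.ext ((reductionRep_eq_self_iff hq σ x).mpr hfσ)⟩, rfl⟩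

/-! ### The values of the character -/

theorem phi_eq_totient {g d n : ℕ} (hn : 0 < n) (h : g * d = n) : phi g n = d.totient := by
  have hg : 0 < g := Nat.pos_of_mul_pos_right (h ▸ hn)
  have hd : n / g = d := by rw [← h, Nat.mul_div_cancel_left _ hg]
  rw [← hd, Nat.totient_div_of_dvd ⟨d, h.symm⟩, phi]
  -- `n` and `0` have the same greatest common divisor with `n`
  rw [Finset.card_filter, Finset.card_filter, Finset.range_eq_Ico,
    Finset.sum_eq_sum_Ico_succ_bot hn, ← Finset.Ico_add_one_right_eq_Icc,
    Finset.sum_Ico_succ_top hn, add_comm, Nat.gcd_self, Nat.gcd_zero_right]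

theorem hasRectangularCycleType_iff {σ : Perm (Fin (ℓ + 1))} {g d : ℕ} (h : g * d = ℓ + 1) :
    HasRectangularCycleType σ g d ↔ ∀ x, minimalPeriod σ x = d :=
  parts_partition_eq_replicate_iff (by rw [h, Fintype.card_fin])
    (Nat.pos_of_mul_pos_left (h.symm ▸ ℓ.succ_pos : 0 < g * d))

theorem chiA_of_hasRectangularCycleType {q : ℕ} (hq : 0 < q) {σ : Perm (Fin (ℓ + 1))} {g d : ℕ}
    (h : g * d = ℓ + 1) (hσ : HasRectangularCycleType σ g d) (hd : d ∣ q) :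
    chiA ℓ q σ = (phi g (ℓ + 1) : ℂ) * ∏ i ∈ Finset.Ico 1 g, ((q : ℂ) - (i : ℂ) * (d : ℂ)) := by
  rw [chiA_eq_card_normalizedInjections hq, phi_eq_totient ℓ.succ_pos h]
  exact card_normalizedInjections 0 hq (by rw [h, Fintype.card_fin]) hd
    ((hasRectangularCycleType_iff h).mp hσ)

theorem chiA_eq_zero {q : ℕ} (hq : 0 < q) {σ : Perm (Fin (ℓ + 1))}
    (h : ¬ ∃ g d : ℕ, g * d = ℓ + 1 ∧ HasRectangularCycleType σ g d ∧ d ∣ q) :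
    chiA ℓ q σ = 0 := by
  have : NeZero q := ⟨hq.ne'⟩
  rw [chiA_eq_card_normalizedInjections hq, Nat.cast_eq_zero, Nat.card_eq_zero]
  refine Or.inl ⟨fun ⟨f, hf, hf0, hfσ⟩ => h ?_⟩
  obtain ⟨g, hg, hparts⟩ :=
    exists_parts_partition_eq_replicate (minimalPeriod_eq_addOrderOf hf hfσ)
  refine ⟨g, _, hg.trans (Fintype.card_fin _), hparts, ?_⟩
  simpa using addOrderOf_dvd_card (x := f (σ 0))

/-! ### The minimum period -/

theorem isPeriod_chiA (ℓ : ℕ) : IsPeriod (chiA ℓ) (ℓ + 1) := by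
  refine ⟨ℓ.succ_pos, ?_⟩
  have key : ∀ (r : ℕ) (σ : Perm (Fin (ℓ + 1))), ∃ p : Polynomial ℂ, ∀ z : ℕ, 0 < z →
      z ≡ r [MOD ℓ + 1] → chiA ℓ z σ = p.eval (z : ℂ) := by
    intro r σ
    have hdvd : ∀ {g d z : ℕ}, g * d = ℓ + 1 → z ≡ r [MOD ℓ + 1] → (d ∣ z ↔ d ∣ r) :=
      fun h hz => hz.dvd_iff ⟨_, by rw [← h, mul_comm]⟩
    by_cases h : ∃ g d : ℕ, g * d = ℓ + 1 ∧ HasRectangularCycleType σ g d ∧ d ∣ r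
    · obtain ⟨g, d, h, hσ, hd⟩ := h
      refine ⟨Polynomial.C (phi g (ℓ + 1) : ℂ) *
        ∏ i ∈ Finset.Ico 1 g, (Polynomial.X - Polynomial.C ((i : ℂ) * (d : ℂ))), fun z hz hzr => ?_⟩
      rw [chiA_of_hasRectangularCycleType hz h hσ ((hdvd h hzr).mpr hd)]
      simp [Polynomial.eval_prod]
    · refine ⟨0, fun z hz hzr => ?_⟩
      rw [Polynomial.eval_zero]
      refine chiA_eq_zero hz fun ⟨g, d, h', hσ, hd⟩ => h ⟨g, d, h', hσ, (hdvd h' hzr).mp hd⟩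
  choose p hp using key
  refine ⟨fun r => (Polynomial.piEquiv fun _ => ℂ).symm (p r), fun r _ z hz hzr => ?_⟩
  ext σ
  have hmap : ((Polynomial.piEquiv fun _ => ℂ).symm (p r)).map
      (Pi.evalRingHom (fun _ : Perm (Fin (ℓ + 1)) => ℂ) σ) = p r σ :=
    congrFun ((Polynomial.piEquiv fun _ => ℂ).apply_symm_apply (p r)) σ
  rw [hp r σ z hz hzr, ← hmap, Polynomial.eval_natCast_map]
  rfl

theorem hasRectangularCycleType_finRotate (ℓ : ℕ) :
    HasRectangularCycleType (finRotate (ℓ + 1)) 1 (ℓ + 1) := by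
  rw [HasRectangularCycleType, Perm.parts_partition]
  cases ℓ with
  | zero => simp [Subsingleton.elim (Equiv.refl (Fin 1)) 1]
  | succ k => simp [cycleType_finRotate]

/-- The value of the character at a cycle of full length is nonzero exactly when `q` is divisible
by `ℓ + 1`. -/
theorem chiA_finRotate_ne_zero_iff {q : ℕ} (hq : 0 < q) :
    chiA ℓ q (finRotate (ℓ + 1)) ≠ 0 ↔ ℓ + 1 ∣ q := by
  have hrot := hasRectangularCycleType_finRotate ℓ
  constructor
  · intro h
    obtain ⟨g, d, hgd, hσ, hd⟩ := not_imp_comm.mp (chiA_eq_zero hq) h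
    rw [hasRectangularCycleType_iff (one_mul _)] at hrot
    rw [hasRectangularCycleType_iff hgd] at hσ
    rwa [← hrot 0, hσ 0]
  · intro h
    rw [chiA_of_hasRectangularCycleType hq (one_mul _) hrot h,
      phi_eq_totient ℓ.succ_pos (one_mul _)]
    simp [Nat.totient_eq_zero]

theorem le_of_isPeriod_chiA {m : ℕ} (h : IsPeriod (chiA ℓ) m) : ℓ + 1 ≤ m := by
  obtain ⟨hm, f, hf⟩ := h
  by_contra! hlt
  have hm1 : m ∈ Finset.Icc 1 m := Finset.mem_Icc.mpr ⟨hm, le_rfl⟩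
  set p := (f m).map (Pi.evalRingHom (fun _ : Perm (Fin (ℓ + 1)) => ℂ) (finRotate (ℓ + 1)))
  have hp : ∀ k : ℕ, chiA ℓ (m * (k + 1)) (finRotate (ℓ + 1)) = p.eval ((m * (k + 1) : ℕ) : ℂ) := by
    intro k
    rw [hf m hm1 (m * (k + 1)) (by positivity) (by simp [Nat.ModEq]), Polynomial.eval_natCast_map]
    rfl
  -- `m` times `1 + (ℓ + 1) j` is never divisible by `ℓ + 1`, since `0 < m < ℓ + 1`
  have hzero : p = 0 := by
    apply Polynomial.eq_zero_of_infinite_isRoot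
    refine Set.infinite_of_injective_forall_mem
      (f := fun j : ℕ => ((m * ((ℓ + 1) * j + 1) : ℕ) : ℂ)) ?_ fun j => ?_
    · intro a b hab
      have := Nat.cast_injective hab
      simpa [hm.ne'] using this
    · change p.eval _ = 0
      rw [← hp]
      by_contra hne
      rw [← ne_eq, chiA_finRotate_ne_zero_iff (by positivity)] at hne
      have : ℓ + 1 ∣ m := by
        rw [mul_add, mul_one] at hne
        exact (Nat.dvd_add_right ⟨m * j, by ring⟩).mp hne
      exact hlt.not_ge (Nat.le_of_dvd hm this)
  have h1 := hp ℓ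
  rw [hzero, Polynomial.eval_zero] at h1
  exact (chiA_finRotate_ne_zero_iff (by positivity)).mpr (dvd_mul_left _ _) h1

end TypeA

end EquivariantCharacteristic

open EquivariantCharacteristic.TypeA in
theorem mainTheorem4 (ℓ : ℕ) :
    (∀ q : ℕ, 0 < q → ∀ σ : Equiv.Perm (Fin (ℓ + 1)),
      (∀ g d : ℕ, g * d = ℓ + 1 →
        EquivariantCharacteristic.TypeA.HasRectangularCycleType σ g d → d ∣ q →
        EquivariantCharacteristic.TypeA.chiA ℓ q σ =
          (EquivariantCharacteristic.TypeA.phi g (ℓ + 1) : ℂ) *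
            ∏ i ∈ Finset.Ico 1 g, ((q : ℂ) - (i : ℂ) * (d : ℂ))) ∧
      ((¬ ∃ g d : ℕ, g * d = ℓ + 1 ∧
          EquivariantCharacteristic.TypeA.HasRectangularCycleType σ g d ∧ d ∣ q) →
        EquivariantCharacteristic.TypeA.chiA ℓ q σ = 0)) ∧
    EquivariantCharacteristic.IsMinimumPeriod
      (EquivariantCharacteristic.TypeA.chiA ℓ) (ℓ + 1) :=
  ⟨fun _ hq _ => ⟨fun _ _ h hσ hd => chiA_of_hasRectangularCycleType hq h hσ hd, chiA_eq_zero hq⟩,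
    isPeriod_chiA ℓ, fun _ => le_of_isPeriod_chiA⟩
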